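/- Let $\mathcal O\subset\mathbb R^d$ be a bounded open set with boundary of class $C^2$, lying locally on one side of its boundary, and let $\nu$ be the outer unit normal on $\partial\mathcal O$. Let $b_1,\dots,b_N\in C^2(\overline{\mathcal O};\mathbb R^d)$ satisfy the following conditions, where $b_i^j$ is the $j$-th component of $b_i$ and $\partial_k$ is the $k$-th partial derivative: (i) $\langle b_i,\nu\rangle=0$ on $\partial\mathcal O$ for all $1\le i\le N$; (ii) $\sum_{k=1}^d b_i^k\,\partial_k b_l^j=\sum_{k=1}^d b_l^k\,\partial_k b_i^j$ on $\overline{\mathcal O}$ for all $1\le j\le d$ and all $1\le i,l\le N$ with $i\neq l$ (no condition if $N=1$); (iii) $\operatorname{div} b_i=0$ and $\langle\Delta b_i,b_i\rangle=0$ on $\overline{\mathcal O}$ for all $1\le i\le N$, where $\Delta$ acts componentwise; (iv) $\sum_{j,k=1}^d(\partial_k b_i^j+\partial_j b_i^k)\,\nu_k\,b_i^j=0$ on $\partial\mathcal O$ for all $1\le i\le N$. Let $u\in C^3(\overline{\mathcal O})$ be a scalar function with $\langle\nabla u,\nu\rangle=0$ on $\partial\mathcal O$. Then for every $1\le i\le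 N$ the function $\langle b_i,\nabla u\rangle$ belongs to $C^2(\overline{\mathcal O})$ and satisfies $\langle\nabla(\langle b_i,\nabla u\rangle),\nu\rangle=0$ on $\partial\mathcal O$. Here $C^k(\overline{\mathcal O})$ denotes the functions that are $k$ times continuously differentiable up to the boundary. -/

import Mathlib

open Set Filter Topology
open scoped InnerProductSpace

/-- `ρ` is a local `C²` defining function of the set `O` at the point `p`: near `p` it is of class
`C²`, it vanishes at `p` with non-zero gradient, and near `p` the set `O` is exactly `{ρ < 0}`.
(`ContDiffAt ℝ 2` means class `C²` on a neighbourhood of `p`.) -/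
structure IsLocalDefiningFunction {d : ℕ} (O : Set (EuclideanSpace ℝ (Fin d)))
    (p : EuclideanSpace ℝ (Fin d)) (ρ : EuclideanSpace ℝ (Fin d) → ℝ) : Prop where
  contDiffAt : ContDiffAt ℝ 2 ρ p
  eq_zero : ρ p = 0
  gradient_ne_zero : gradient ρ p ≠ 0
  mem_iff : ∀ᶠ x in 𝓝 p, x ∈ O ↔ ρ x < 0

/-- `O` has a boundary of class `C²` and lies locally on one side of it. -/
def HasC2Boundary {d : ℕ} (O : Set (EuclideanSpace ℝ (Fin d))) : Prop :=
  ∀ p ∈ frontier O, ∃ ρ, IsLocalDefiningFunction O p ρ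

/-- `n` is the outer unit normal to `O` at the boundary point `p`: the normalised gradient of a
local defining function. -/
def IsOuterUnitNormal {d : ℕ} (O : Set (EuclideanSpace ℝ (Fin d)))
    (p n : EuclideanSpace ℝ (Fin d)) : Prop :=
  ∃ ρ, IsLocalDefiningFunction O p ρ ∧ n = ‖gradient ρ p‖⁻¹ • gradient ρ p

/-- The divergence `∑ j, ∂_j b^j` of a vector field, with derivatives taken within `K`. -/
noncomputable def divWithin {d : ℕ}
    (b : EuclideanSpace ℝ (Fin d) → EuclideanSpace ℝ (Fin d))
    (K : Set (EuclideanSpace ℝ (Fin d))) (x : EuclideanSpace ℝ (Fin d)) : ℝ :=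
  ∑ j, fderivWithin ℝ b K x (EuclideanSpace.single j 1) j

/-- The operator `u ↦ ⟨b, ∇u⟩`, with the gradient taken within `K`. -/
noncomputable def noiseOp {d : ℕ} (K : Set (EuclideanSpace ℝ (Fin d)))
    (b : EuclideanSpace ℝ (Fin d) → EuclideanSpace ℝ (Fin d))
    (u : EuclideanSpace ℝ (Fin d) → ℝ) (x : EuclideanSpace ℝ (Fin d)) : ℝ :=
  ⟪b x, gradientWithin u K x⟫_ℝ

/-- The normal derivative `⟨∇u, ν⟩` (with `∇` taken within the closure of `O`) vanishes at every
point of the boundary of `O`. -/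
def ZeroNormalDerivative {d : ℕ} (O : Set (EuclideanSpace ℝ (Fin d)))
    (ν : EuclideanSpace ℝ (Fin d) → EuclideanSpace ℝ (Fin d))
    (u : EuclideanSpace ℝ (Fin d) → ℝ) : Prop :=
  ∀ x ∈ frontier O, ⟪gradientWithin u (closure O) x, ν x⟫_ℝ = 0

/-- The standing hypotheses on the coefficient fields `b_1, …, b_N` on the closure of `O`, where
`ν` is the outer unit normal field. All derivatives are taken within the closure of `O`; `Db(x) v`
(Mathlib's `fderivWithin`) is the vector with the components `∑ k, v^k ∂_k b^j`. -/
structure NoiseAssumption {d N : ℕ} (O : Set (EuclideanSpace ℝ (Fin d)))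
    (ν : EuclideanSpace ℝ (Fin d) → EuclideanSpace ℝ (Fin d))
    (b : Fin N → EuclideanSpace ℝ (Fin d) → EuclideanSpace ℝ (Fin d)) : Prop where
  /-- `b_i` is of class `C²` up to the boundary. -/
  contDiffOn : ∀ i, ContDiffOn ℝ 2 (b i) (closure O)
  /-- `⟨b_i, ν⟩ = 0` on the boundary. -/
  tangent : ∀ i, ∀ x ∈ frontier O, ⟪b i x, ν x⟫_ℝ = 0
  /-- `∑ k, b_i^k ∂_k b_l^j = ∑ k, b_l^k ∂_k b_i^j` for all `j`, all `i ≠ l`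
  (no condition if `N = 1`). -/
  commute : ∀ i l, i ≠ l → ∀ x ∈ closure O,
    fderivWithin ℝ (b l) (closure O) x (b i x) = fderivWithin ℝ (b i) (closure O) x (b l x)
  /-- `div b_i = 0` on the closure. -/
  div_eq_zero : ∀ i, ∀ x ∈ closure O, divWithin (b i) (closure O) x = 0
  /-- `⟨Δ b_i, b_i⟩ = 0` on the closure, with the componentwise Laplacian. -/
  laplacian : ∀ i, ∀ x ∈ closure O,
    ⟪InnerProductSpace.laplacianWithin (b i) (closure O) x, b i x⟫_ℝ = 0
  /-- `∑ j k, (∂_k b_i^j + ∂_j b_i^k) ν_k b_i^j = 0` on the boundary. -/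
  boundary : ∀ i, ∀ x ∈ frontier O,
    ⟪fderivWithin ℝ (b i) (closure O) x (ν x), b i x⟫_ℝ
      + ⟪fderivWithin ℝ (b i) (closure O) x (b i x), ν x⟫_ℝ = 0

/-! The heart is that each `b = b_i` is a Killing field: `Db + (Db)ᵀ = 0` on the closure. Put `F =
(Db + (Db)ᵀ) b`. The conditions `div b = 0` and `⟨Δb, b⟩ = 0` give `div F = ½ |Db + (Db)ᵀ|²`, while
condition (iv) says that `F` is tangent to the boundary. The divergence theorem gives `∫ div F = 0`,
so the nonnegative continuous `div F` vanishes (`inner_fderivWithin_add_inner_eq_zero`).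

At a boundary point let `ρ` be a local defining function, `a = ∇ρ`, `g = ∇u`. Both `b` and `g` are
tangent there. Differentiating `⟨b, ∇ρ⟩ = 0` along `g` and `⟨∇u, ∇ρ⟩ = 0` along `b`, the terms
`D²ρ(g, b)` cancel by symmetry and `D²u(b, a) = ⟨a, Db g⟩` remains. The Killing identity turns the
right side into `-⟨g, Db a⟩`, so the derivative `D²u(a, b) + ⟨g, Db a⟩` of `⟨b, ∇u⟩` along `a` is
zero.

The divergence theorem for tangential fields (`setIntegral_divWithin_eq_zero`) is obtained without
surface integrals, by cutting off with the distance to the complement. -/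

theorem IsPreconnected.inter_frontier_nonempty_of_mem {X : Type*} [TopologicalSpace X]
    {t O : Set X} (ht : IsPreconnected t) (h1 : (t ∩ O).Nonempty) (h2 : (t ∩ Oᶜ).Nonempty) :
    (t ∩ frontier O).Nonempty := by
  by_contra hne
  have hf : ∀ x ∈ t, x ∈ closure O → x ∈ interior O := fun x hx hc => by
    by_contra hi
    exact hne ⟨x, hx, hc, hi⟩
  obtain ⟨x, hx, hxO⟩ := h1
  obtain ⟨y, hy, hyO⟩ := h2
  obtain ⟨z, -, hz1, hz2⟩ := ht (interior O) (closure O)ᶜ isOpen_interior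
    isClosed_closure.isOpen_compl (fun z hz => (em (z ∈ closure O)).imp (hf z hz) id)
    ⟨x, hx, hf x hx (subset_closure hxO)⟩
    ⟨y, hy, fun hc => hyO (interior_subset (hf y hy hc))⟩
  exact hz2 (subset_closure (interior_subset hz1))

/-! ### Normals described by directions, and tangent vectors of the boundary -/

section ConeNormal

variable {E : Type*} [NormedAddCommGroup E] [InnerProductSpace ℝ E]

/-- `n` is a unit vector such that, from `p`, one enters `O` along every direction making an
obtuse angle with `n` and leaves `O` along every direction making an acute angle with `n`. -/
structure IsConeNormal (O : Set E) (p n : E) : Prop where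
  norm_eq_one : ‖n‖ = 1
  eventually_mem : ∀ v, ⟪n, v⟫_ℝ < 0 → ∀ᶠ t : ℝ in 𝓝[>] 0, p + t • v ∈ O
  eventually_notMem : ∀ v, 0 < ⟪n, v⟫_ℝ → ∀ᶠ t : ℝ in 𝓝[>] 0, p + t • v ∉ O

theorem tendsto_add_smul_nhdsGT (p v : E) :
    Tendsto (fun t : ℝ => p + t • v) (𝓝[>] 0) (𝓝 p) := by
  have h : Continuous fun t : ℝ => p + t • v := by fun_prop
  have h2 := (h.tendsto 0).mono_left (nhdsWithin_le_nhds (s := Ioi 0))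
  simpa using h2

namespace IsConeNormal

variable {O : Set E} {p n m : E}

theorem inner_self (h : IsConeNormal O p n) : ⟪n, n⟫_ℝ = 1 := by
  rw [real_inner_self_eq_norm_sq, h.norm_eq_one]; norm_num

theorem not_inner_neg_pos (hn : IsConeNormal O p n) (hm : IsConeNormal O p m) (v : E)
    (h1 : ⟪n, v⟫_ℝ < 0) (h2 : 0 < ⟪m, v⟫_ℝ) : False := by
  obtain ⟨t, h, h'⟩ := ((hn.eventually_mem v h1).and (hm.eventually_notMem v h2)).exists
  exact h' h

/-- For distinct unit vectors, `m - n` makes an obtuse angle with `n` and an acute one with `m`, so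
it would both enter and leave `O`. -/
theorem unique (hn : IsConeNormal O p n) (hm : IsConeNormal O p m) : n = m := by
  by_contra hne
  have hlt : ⟪n, m⟫_ℝ < 1 :=
    (inner_lt_one_iff_real_of_norm_eq_one hn.norm_eq_one hm.norm_eq_one).2 hne
  refine hn.not_inner_neg_pos hm (m - n) ?_ ?_
  · rw [inner_sub_right, hn.inner_self]; linarith
  · rw [inner_sub_right, hm.inner_self, real_inner_comm]; linarith

/-- If a ball contained in `O` touches the boundary at `q`, then the normal at `q` is the outer
normal of the ball. -/
theorem sub_eq_of_ball_subset {x q : E} (hn : IsConeNormal O q n) (hpos : 0 < dist x q)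
    (hball : Metric.ball x (dist x q) ⊆ O) : x - q = -(dist x q • n) := by
  set δ := dist x q with hδ
  set e := δ⁻¹ • (x - q) with he
  have hxq : x - q = δ • e := by rw [he, smul_inv_smul₀ hpos.ne']
  have hne : ‖e‖ = 1 := by
    rw [he, norm_smul, ← dist_eq_norm, ← hδ, norm_inv, Real.norm_of_nonneg hpos.le,
      inv_mul_cancel₀ hpos.ne']
  have hee : ⟪e, e⟫_ℝ = 1 := by rw [real_inner_self_eq_norm_sq, hne]; norm_num
  -- The squared distance from `x` to `q + t • v` is `δ² - 2δt⟨e, v⟩ + t²‖v‖²`, less than `δ²` for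
  -- small `t > 0`.
  have key : ∀ v, 0 < ⟪e, v⟫_ℝ → ∀ᶠ t : ℝ in 𝓝[>] 0, q + t • v ∈ O := by
    intro v hv
    have hc : Tendsto (fun t : ℝ => t * ‖v‖ ^ 2) (𝓝[>] 0) (𝓝 0) := by
      have h : Continuous fun t : ℝ => t * ‖v‖ ^ 2 := by fun_prop
      simpa using (h.tendsto 0).mono_left (nhdsWithin_le_nhds (s := Ioi 0))
    have h2 : 0 < 2 * δ * ⟪e, v⟫_ℝ := by positivity
    filter_upwards [hc.eventually_lt_const h2, self_mem_nhdsWithin] with t ht ht0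
    refine hball ?_
    rw [Metric.mem_ball, dist_comm, dist_eq_norm]
    have ht0' : (0 : ℝ) < t := ht0
    have : ‖x - (q + t • v)‖ ^ 2 < δ ^ 2 := by
      rw [show x - (q + t • v) = δ • e - t • v by rw [← hxq]; abel, norm_sub_sq_real,
        norm_smul δ e, norm_smul t v, hne, inner_smul_left, inner_smul_right, Real.norm_eq_abs,
        Real.norm_eq_abs, mul_pow, mul_pow, sq_abs, sq_abs]
      simp only [conj_trivial]
      nlinarith
    exact lt_of_pow_lt_pow_left₀ 2 hpos.le this
  -- Otherwise `n + e` makes acute angles with both `e` and `n`: it enters the ball, hence `O`, and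
  -- also leaves `O`.
  have hen : e = -n := by
    by_contra hne'
    have hlt : ⟪e, -n⟫_ℝ < 1 :=
      (inner_lt_one_iff_real_of_norm_eq_one hne (by rw [norm_neg, hn.norm_eq_one])).2 hne'
    rw [inner_neg_right] at hlt
    have h1 : 0 < ⟪e, n + e⟫_ℝ := by rw [inner_add_right, hee]; linarith
    have h2 : 0 < ⟪n, n + e⟫_ℝ := by
      rw [inner_add_right, hn.inner_self, real_inner_comm]; linarith
    obtain ⟨t, h, h'⟩ := ((key _ h1).and (hn.eventually_notMem _ h2)).exists
    exact h' h
  rw [hxq, hen, smul_neg]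

/-- The tangent cone contains the open half-space `⟨n, v⟩ < 0`, which spans. This makes derivatives
within the closure unique at boundary points. -/
theorem uniqueDiffWithinAt [CompleteSpace E] (hn : IsConeNormal O p n) :
    UniqueDiffWithinAt ℝ O p := by
  have hneg : ∀ v, ⟪n, v⟫_ℝ < 0 → v ∈ tangentConeAt ℝ O p := by
    intro v hv
    refine mem_tangentConeAt_of_seq (𝓝[>] (0 : ℝ)) (fun t => t⁻¹) (fun t => t • v) ?_
      (hn.eventually_mem v hv) ?_
    · simpa using tendsto_add_smul_nhdsGT 0 v
    · refine tendsto_const_nhds.congr' ?_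
      filter_upwards [self_mem_nhdsWithin] with t ht
      rw [inv_smul_smul₀ (ne_of_gt ht)]
  have hnn : ⟪n, -n⟫_ℝ < 0 := by rw [inner_neg_right, hn.inner_self]; norm_num
  refine ⟨?_, mem_closure_of_nonempty_tangentConeAt ⟨_, hneg _ hnn⟩⟩
  have htop : Submodule.span ℝ (tangentConeAt ℝ O p) = ⊤ := by
    refine eq_top_iff.2 fun v _ => ?_
    have hv : ⟪n, v - (⟪n, v⟫_ℝ + 1) • n⟫_ℝ < 0 := by
      rw [inner_sub_right, inner_smul_right, hn.inner_self]; linarith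
    have h1 := Submodule.subset_span (R := ℝ) (hneg _ hv)
    have h2 := Submodule.smul_mem _ (-(⟪n, v⟫_ℝ + 1)) (Submodule.subset_span (R := ℝ) (hneg _ hnn))
    have := Submodule.add_mem _ h1 h2
    have hv2 : v = v - (⟪n, v⟫_ℝ + 1) • n + -(⟪n, v⟫_ℝ + 1) • -n := by module
    rwa [hv2]
  rw [htop]; simp

/-- Vectors orthogonal to the normal are tangent to the boundary. -/
theorem mem_tangentConeAt_frontier (hn : IsConeNormal O p n) {w : E} (hw : ⟪n, w⟫_ℝ = 0) :
    w ∈ tangentConeAt ℝ (frontier O) p := by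
  -- For small `t` the segment `s ↦ p + t • (w + s • n)`, `|s| ≤ ε`, starts in `O` and ends outside,
  -- so it crosses the boundary.
  have key : ∀ ε : ℝ, 0 < ε → ∃ t : ℝ, 0 < t ∧ t < ε ∧ ∃ s : ℝ, |s| ≤ ε ∧
      p + t • (w + s • n) ∈ frontier O := by
    intro ε hε
    have h1 := hn.eventually_mem (w + (-ε) • n) (by
      rw [inner_add_right, inner_smul_right, hn.inner_self, hw]; linarith)
    have h2 := hn.eventually_notMem (w + ε • n) (by
      rw [inner_add_right, inner_smul_right, hn.inner_self, hw]; linarith)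
    obtain ⟨t, ⟨h1, h2⟩, h3, h4⟩ := ((h1.and h2).and (Ioo_mem_nhdsGT hε)).exists
    refine ⟨t, h3, h4, ?_⟩
    have hcont : Continuous fun s : ℝ => p + t • (w + s • n) := by fun_prop
    have hpre : IsPreconnected ((fun s : ℝ => p + t • (w + s • n)) '' Icc (-ε) ε) :=
      isPreconnected_Icc.image _ hcont.continuousOn
    have hl : -ε ∈ Icc (-ε) ε := ⟨le_rfl, by linarith⟩
    have hr : ε ∈ Icc (-ε) ε := ⟨by linarith, le_rfl⟩
    obtain ⟨_, ⟨s, hs, rfl⟩, hy⟩ := hpre.inter_frontier_nonempty_of_mem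
      ⟨_, mem_image_of_mem _ hl, h1⟩ ⟨_, mem_image_of_mem _ hr, h2⟩
    exact ⟨s, abs_le.2 hs, hy⟩
  choose! t ht0 htε s hs hmem using key
  have hid : Tendsto (fun ε : ℝ => ε) (𝓝[>] 0) (𝓝 0) := nhdsWithin_le_nhds
  have htlim : Tendsto t (𝓝[>] 0) (𝓝 0) := by
    refine tendsto_of_tendsto_of_tendsto_of_le_of_le' tendsto_const_nhds hid ?_ ?_
    · filter_upwards [self_mem_nhdsWithin] with ε hε using (ht0 ε hε).le
    · filter_upwards [self_mem_nhdsWithin] with ε hε using (htε ε hε).le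
  have hslim : Tendsto s (𝓝[>] 0) (𝓝 0) := by
    refine squeeze_zero_norm' ?_ hid
    filter_upwards [self_mem_nhdsWithin] with ε hε using hs ε hε
  have hvlim : Tendsto (fun ε => w + s ε • n) (𝓝[>] 0) (𝓝 w) := by
    simpa using tendsto_const_nhds.add (hslim.smul_const n)
  refine mem_tangentConeAt_of_seq (𝓝[>] (0 : ℝ)) (fun ε => (t ε)⁻¹)
    (fun ε => t ε • (w + s ε • n)) ?_ ?_ ?_
  · simpa using htlim.smul hvlim
  · filter_upwards [self_mem_nhdsWithin] with ε hε using hmem ε hε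
  · refine hvlim.congr' ?_
    filter_upwards [self_mem_nhdsWithin] with ε hε
    rw [inv_smul_smul₀ (ht0 ε hε).ne']

end IsConeNormal

/-- A function vanishing on the boundary has zero derivative along tangent vectors. -/
theorem HasFDerivWithinAt.eq_zero_of_tangent {O : Set E} {p n w : E} (hn : IsConeNormal O p n)
    (hw : ⟪n, w⟫_ℝ = 0) {g : E → ℝ} {g' : E →L[ℝ] ℝ} {s : Set E}
    (hg : HasFDerivWithinAt g g' s p) (hs : frontier O ⊆ s) (hp : p ∈ frontier O)
    (hz : ∀ᶠ x in 𝓝[frontier O] p, g x = 0) : g' w = 0 := by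
  have h0 : HasFDerivWithinAt g (0 : E →L[ℝ] ℝ) (frontier O) p :=
    (hasFDerivWithinAt_const (0 : ℝ) p (frontier O)).congr_of_eventuallyEq hz
      (hz.self_of_nhdsWithin hp)
  simpa using (hg.mono hs).unique_on h0 (hn.mem_tangentConeAt_frontier hw)

end ConeNormal

/-! ### Local defining functions -/

section DefiningFunction

variable {d : ℕ} {O : Set (EuclideanSpace ℝ (Fin d))} {p n : EuclideanSpace ℝ (Fin d)}
  {ρ : EuclideanSpace ℝ (Fin d) → ℝ}

theorem IsLocalDefiningFunction.isConeNormal (h : IsLocalDefiningFunction O p ρ) :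
    IsConeNormal O p (‖gradient ρ p‖⁻¹ • gradient ρ p) := by
  have hpos : 0 < ‖gradient ρ p‖⁻¹ := inv_pos.2 (norm_pos_iff.2 h.gradient_ne_zero)
  have hdiff : HasFDerivAt ρ (fderiv ℝ ρ p) p :=
    (h.contDiffAt.differentiableAt (by norm_num)).hasFDerivAt
  have hinner : ∀ v, ⟪‖gradient ρ p‖⁻¹ • gradient ρ p, v⟫_ℝ = ‖gradient ρ p‖⁻¹ * fderiv ℝ ρ p v := by
    intro v
    rw [inner_smul_left, inner_gradient_left]; simp
  have hlim : ∀ v, Tendsto (fun t : ℝ => t⁻¹ • (ρ (p + t • v) - ρ p)) (𝓝[>] 0)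
      (𝓝 (fderiv ℝ ρ p v)) := fun v => (hdiff.hasLineDerivAt v).tendsto_slope_zero_right
  refine ⟨?_, ?_, ?_⟩
  · rw [norm_smul, norm_inv, norm_norm, inv_mul_cancel₀ (norm_ne_zero_iff.2 h.gradient_ne_zero)]
  · intro v hv
    rw [hinner] at hv
    have hv' : fderiv ℝ ρ p v < 0 := by
      by_contra hc
      exact absurd hv (not_lt.2 (mul_nonneg hpos.le (not_lt.1 hc)))
    filter_upwards [(hlim v).eventually_lt_const hv', self_mem_nhdsWithin,
      (tendsto_add_smul_nhdsGT p v).eventually h.mem_iff] with t h1 h2 h3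
    rw [h3]
    rw [h.eq_zero, sub_zero, smul_eq_mul] at h1
    exact (pos_iff_neg_of_mul_neg h1).1 (inv_pos.2 h2)
  · intro v hv
    rw [hinner] at hv
    have hv' : 0 < fderiv ℝ ρ p v := (pos_iff_pos_of_mul_pos hv).1 hpos
    filter_upwards [(hlim v).eventually_const_lt hv', self_mem_nhdsWithin,
      (tendsto_add_smul_nhdsGT p v).eventually h.mem_iff] with t h1 h2 h3
    rw [h3, not_lt]
    rw [h.eq_zero, sub_zero, smul_eq_mul] at h1
    exact ((pos_iff_pos_of_mul_pos h1).1 (inv_pos.2 h2)).le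

theorem IsOuterUnitNormal.isConeNormal (h : IsOuterUnitNormal O p n) : IsConeNormal O p n := by
  obtain ⟨ρ, hρ, rfl⟩ := h
  exact hρ.isConeNormal

/-- One `ρ` serves all nearby boundary points, so there the normal is a multiple of the `C¹` field
`∇ρ`, which can be differentiated. Only `ρ q = 0` needs care: the sign of `ρ` decides membership,
and `q` lies in the closure of the open set `O` but not in `O`. -/
theorem IsLocalDefiningFunction.eventually_frontier (hO : IsOpen O)
    (h : IsLocalDefiningFunction O p ρ) :
    ∀ᶠ q in 𝓝[frontier O] p, IsLocalDefiningFunction O q ρ := by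
  have hgrad : ContinuousAt (gradient ρ) p := by
    have h1 : ContinuousAt (fderiv ℝ ρ) p :=
      (h.contDiffAt.fderiv_right (m := 0) (by norm_num)).continuousAt
    exact (InnerProductSpace.toDual ℝ _).symm.continuous.continuousAt.comp h1
  rw [eventually_nhdsWithin_iff]
  filter_upwards [h.contDiffAt.eventually (by simp), hgrad.eventually_ne h.gradient_ne_zero,
    h.mem_iff.eventually_nhds] with q h1 h2 h3 hq
  refine ⟨h1, le_antisymm ?_ ?_, h2, h3⟩
  · by_contra hc
    have : ∀ᶠ x in 𝓝 q, x ∉ O := by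
      filter_upwards [h3, h1.continuousAt.eventually_const_lt (not_le.1 hc)] with x hx hx'
      rw [hx]; exact not_lt.2 hx'.le
    exact (mem_closure_iff_frequently.1 (frontier_subset_closure hq)) this
  · rw [← not_lt, ← h3.self_of_nhds]
    rw [hO.frontier_eq] at hq
    exact hq.2

theorem IsOpen.uniqueDiffOn_closure_of_isConeNormal (hO : IsOpen O)
    (h : ∀ q ∈ frontier O, ∃ n, IsConeNormal O q n) : UniqueDiffOn ℝ (closure O) := by
  intro x hx
  by_cases hxO : x ∈ O
  · exact ((hO.uniqueDiffWithinAt hxO).mono subset_closure)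
  · obtain ⟨n, hn⟩ := h x (by rw [hO.frontier_eq]; exact ⟨hx, hxO⟩)
    exact hn.uniqueDiffWithinAt.mono subset_closure

end DefiningFunction

/-! ### Integration by parts with compact support -/

section Divergence

open MeasureTheory

variable {d : ℕ} {O : Set (EuclideanSpace ℝ (Fin d))}
  {F : EuclideanSpace ℝ (Fin d) → EuclideanSpace ℝ (Fin d)}

/-- Integration by parts for the divergence against a Lipschitz function which is compactly
supported in an open set. -/
theorem integral_mul_divWithin_univ (hO : IsOpen O) (hF : ContDiffOn ℝ 1 F O)
    {g : EuclideanSpace ℝ (Fin d) → ℝ} {C : NNReal} (hg : LipschitzWith C g)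
    (hc : HasCompactSupport g) (hsub : tsupport g ⊆ O) :
    ∫ x, g x * divWithin F univ x = -∫ x, fderiv ℝ g x (F x) := by
  obtain ⟨L, hL, hgL, hLO⟩ := exists_compact_between hc hO hsub
  -- `F` is `C¹` only on `O`. With `ψ = 1` near the support of `g`, the products `ψ F_k` are `C¹` on
  -- the whole space and agree with `F_k` where it matters.
  obtain ⟨ψ, hψ1, hψ0, -⟩ := exists_contMDiffMap_one_nhds_of_subset_interior (n := 1)
    (modelWithCornersSelf ℝ (EuclideanSpace ℝ (Fin d))) (isClosed_tsupport g) hgL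
  have hψs : tsupport ψ ⊆ L := closure_minimal
    (fun x hx => by by_contra h; exact hx (hψ0 x h)) hL.isClosed
  have hψd : ContDiff ℝ 1 ψ := ψ.contMDiff.contDiff
  let f : Fin d → EuclideanSpace ℝ (Fin d) → ℝ := fun k x => ψ x * F x k
  let e : Fin d → EuclideanSpace ℝ (Fin d) := fun k => EuclideanSpace.single k 1
  have hfd : ∀ k, ContDiff ℝ 1 (f k) := by
    intro k
    refine contDiff_iff_contDiffAt.2 fun x => ?_
    by_cases hx : x ∈ O
    · have h1 : ContDiffAt ℝ 1 F x := hF.contDiffAt (hO.mem_nhds hx)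
      exact hψd.contDiffAt.mul ((contDiffAt_euclidean.1 h1) k)
    · have h0 : ψ =ᶠ[𝓝 x] 0 := notMem_tsupport_iff_eventuallyEq.1 fun h => hx (hLO (hψs h))
      refine (contDiffAt_const (c := (0 : ℝ))).congr_of_eventuallyEq ?_
      filter_upwards [h0] with y hy
      simp [f, hy]
  have hfc : ∀ k, HasCompactSupport (f k) := fun k =>
    (HasCompactSupport.of_support_subset_isCompact hL
      ((subset_tsupport _).trans hψs)).mul_right
  have hfg : ∀ x ∈ tsupport g, ∀ k, f k =ᶠ[𝓝 x] fun y => F y k := by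
    intro x hx k
    filter_upwards [hψ1.filter_mono (nhds_le_nhdsSet hx)] with y hy
    simp [f, hy]
  have hparts : ∀ k, ∫ x, lineDeriv ℝ (f k) x (e k) * g x
      = ∫ x, lineDeriv ℝ g x (-e k) * f k x := by
    intro k
    obtain ⟨D, hD⟩ := ContDiff.lipschitzWith_of_hasCompactSupport (hfc k) (hfd k) one_ne_zero
    exact hD.integral_lineDeriv_mul_eq hg hc _
  have hl : ∀ x, g x * divWithin F univ x = ∑ k, lineDeriv ℝ (f k) x (e k) * g x := by
    intro x
    by_cases hx : g x = 0
    · simp [hx]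
    have hx' := subset_tsupport g hx
    have hFx : HasFDerivAt F (fderiv ℝ F x) x :=
      ((hF.contDiffAt (hO.mem_nhds (hsub hx'))).differentiableAt one_ne_zero).hasFDerivAt
    rw [divWithin, Finset.mul_sum]
    refine Finset.sum_congr rfl fun k _ => ?_
    have hk : HasFDerivAt (f k) ((EuclideanSpace.proj k).comp (fderiv ℝ F x)) x :=
      (((EuclideanSpace.proj (𝕜 := ℝ) k).hasFDerivAt.comp x hFx)).congr_of_eventuallyEq
        (hfg x hx' k)
    rw [(hk.hasLineDerivAt (e k)).lineDeriv, fderivWithin_univ, mul_comm]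
    rfl
  -- By Rademacher's theorem, line derivatives of the Lipschitz `g` come from its differential
  -- almost everywhere.
  have hr : (fun x => ∑ k, lineDeriv ℝ g x (-e k) * f k x)
      =ᵐ[volume] fun x => -(fderiv ℝ g x (F x)) := by
    filter_upwards [hg.ae_differentiableAt (μ := volume)] with x hx
    simp only [hx.lineDeriv_eq_fderiv]
    by_cases hxs : x ∈ tsupport g
    · have hdec : F x = ∑ k, F x k • e k := by
        have := (EuclideanSpace.basisFun (Fin d) ℝ).sum_repr (F x)
        simpa [e] using this.symm
      conv_rhs => rw [hdec]
      rw [map_sum, ← Finset.sum_neg_distrib]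
      refine Finset.sum_congr rfl fun k _ => ?_
      rw [(hfg x hxs k).self_of_nhds, map_smul, map_neg, smul_eq_mul]
      ring
    · have h0 : fderiv ℝ g x = 0 := by
        rw [(notMem_tsupport_iff_eventuallyEq.1 hxs).fderiv_eq]
        exact fderiv_const_apply 0
      simp [h0]
  simp_rw [hl]
  rw [integral_finsetSum, Finset.sum_congr rfl fun k _ => hparts k, ← integral_finsetSum,
    integral_congr_ae hr, integral_neg]
  · intro k _
    exact (((hfd k).continuous.integrable_of_hasCompactSupport (hfc k)).bdd_mul
      (hg.memLp_lineDeriv (-e k)).1 (Eventually.of_forall fun x =>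
        norm_lineDeriv_le_of_lipschitz ℝ hg))
  · intro k _
    obtain ⟨D, hD⟩ := ContDiff.lipschitzWith_of_hasCompactSupport (hfc k) (hfd k) one_ne_zero
    exact ((hg.continuous.integrable_of_hasCompactSupport hc).bdd_mul
      (hD.memLp_lineDeriv (e k)).1 (Eventually.of_forall fun x =>
        norm_lineDeriv_le_of_lipschitz ℝ hD))

theorem exists_deriv_smoothTransition_bound :
    ∃ L : NNReal, ∀ y, ‖deriv Real.smoothTransition y‖₊ ≤ L := by
  have hcd : ContDiff ℝ 1 Real.smoothTransition := Real.smoothTransition.contDiff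
  have hc : HasCompactSupport (deriv Real.smoothTransition) := by
    refine HasCompactSupport.of_support_subset_isCompact (isCompact_Icc (a := (0 : ℝ)) (b := 1)) ?_
    intro y hy
    by_contra h
    rw [mem_Icc, not_and_or, not_le, not_le] at h
    refine hy ?_
    rcases h with h | h
    · have : Real.smoothTransition =ᶠ[𝓝 y] fun _ => 0 := by
        filter_upwards [Iio_mem_nhds h] with z hz
          using Real.smoothTransition.zero_of_nonpos (le_of_lt hz)
      rw [this.deriv_eq, deriv_const]
    · have : Real.smoothTransition =ᶠ[𝓝 y] fun _ => 1 := by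
        filter_upwards [Ioi_mem_nhds h] with z hz
          using Real.smoothTransition.one_of_one_le (le_of_lt hz)
      rw [this.deriv_eq, deriv_const]
  obtain ⟨L, hL⟩ := hc.exists_bound_of_continuous (hcd.continuous_deriv le_rfl)
  exact ⟨L.toNNReal, fun y => by
    rw [← NNReal.coe_le_coe, coe_nnnorm]; exact (hL y).trans (Real.le_coe_toNNReal L)⟩

end Divergence

/-! ### The distance function and its nearest points -/

section Distance

variable {E : Type*} [NormedAddCommGroup E] [InnerProductSpace ℝ E]

/-- Where it is differentiable, the distance to a set has the direction from a nearest point as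
its gradient. -/
theorem infDist_mul_fderiv_infDist {S : Set E} {x q : E} (hq : q ∈ S)
    (hd : Metric.infDist x S = dist x q)
    (hdiff : DifferentiableAt ℝ (fun y => Metric.infDist y S) x) (v : E) :
    dist x q * fderiv ℝ (fun y => Metric.infDist y S) x v = ⟪x - q, v⟫_ℝ := by
  have h1 := (hdiff.hasFDerivAt.pow 2).sub
    (((hasFDerivAt_id x).sub_const q).norm_sq)
  -- This difference is at most `0` everywhere and equals `0` at `x`.
  have hmax : IsLocalMax (fun y => Metric.infDist y S ^ 2 - ‖id y - q‖ ^ 2) x := by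
    refine Eventually.of_forall fun y => ?_
    have h2 : Metric.infDist y S ≤ dist y q := Metric.infDist_le_dist_of_mem hq
    have h3 := pow_le_pow_left₀ Metric.infDist_nonneg h2 2
    simp only [id, ← dist_eq_norm, hd]
    linarith
  have h4 := congrArg (fun l => l v) (hmax.hasFDerivAt_eq_zero h1)
  simp [hd, ← inner_sub_left] at h4
  linarith

/-- A nearest point in the complement of an open set. -/
theorem IsOpen.exists_frontier_infDist_compl [ProperSpace E] {O : Set E} (hO : IsOpen O)
    (hne : (Oᶜ).Nonempty) {x : E} (hx : x ∈ O) :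
    ∃ q ∈ frontier O, Metric.infDist x Oᶜ = dist x q ∧ 0 < dist x q ∧
      Metric.ball x (dist x q) ⊆ O := by
  obtain ⟨q, hq, hd⟩ := hO.isClosed_compl.exists_infDist_eq_dist hne x
  have hpos : 0 < dist x q := dist_pos.2 fun h => hq (h ▸ hx)
  have hb : Metric.ball x (dist x q) ⊆ O := fun y hy => by
    by_contra hyO
    have := Metric.infDist_le_dist_of_mem (x := x) (mem_compl hyO)
    rw [Metric.mem_ball, dist_comm] at hy
    linarith
  refine ⟨q, ?_, hd, hpos, hb⟩
  rw [hO.frontier_eq]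
  refine ⟨closure_mono hb ?_, hq⟩
  rw [closure_ball x hpos.ne', Metric.mem_closedBall, dist_comm]

end Distance

/-! ### The divergence theorem for tangential fields -/

section Divergence

open MeasureTheory

variable {d : ℕ} {O : Set (EuclideanSpace ℝ (Fin d))}
  {F : EuclideanSpace ℝ (Fin d) → EuclideanSpace ℝ (Fin d)}

/-- The gradient of the distance at `x` is `-n`, with `n` the normal at a nearest boundary point
`q`. As `⟨F q, n⟩ = 0`, the derivative is `-⟨n, F x - F q⟩`, which the mean value inequality
controls. -/
theorem abs_fderiv_infDist_compl_le (hO : IsOpen O) (hne : (Oᶜ).Nonempty)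
    (hF : DifferentiableOn ℝ F (closure O)) {C : ℝ}
    (hC : ∀ x ∈ closure O, ‖fderivWithin ℝ F (closure O) x‖ ≤ C)
    (hFn : ∀ q ∈ frontier O, ∃ n, IsConeNormal O q n ∧ ⟪F q, n⟫_ℝ = 0)
    {x : EuclideanSpace ℝ (Fin d)} (hx : x ∈ O)
    (hdiff : DifferentiableAt ℝ (fun y => Metric.infDist y Oᶜ) x) :
    |fderiv ℝ (fun y => Metric.infDist y Oᶜ) x (F x)| ≤ C * Metric.infDist x Oᶜ := by
  obtain ⟨q, hq, hd, hpos, hball⟩ := hO.exists_frontier_infDist_compl hne hx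
  obtain ⟨n, hn, hFq⟩ := hFn q hq
  have hqO : q ∈ Oᶜ := by rw [hO.frontier_eq] at hq; exact hq.2
  have h1 := infDist_mul_fderiv_infDist hqO hd hdiff (F x)
  -- The mean value inequality needs a convex set containing `x` and `q`; this ball replaces
  -- `closure O`.
  have hcb : Metric.closedBall x (dist x q) ⊆ closure O := by
    rw [← closure_ball x hpos.ne']; exact closure_mono hball
  have h2 : ‖F x - F q‖ ≤ C * ‖x - q‖ :=
    (convex_closedBall x (dist x q)).norm_image_sub_le_of_norm_hasFDerivWithin_le
      (fun y hy => (hF y (hcb hy)).hasFDerivWithinAt.mono hcb) (fun y hy => hC y (hcb hy))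
      (by rw [Metric.mem_closedBall, dist_comm]) (Metric.mem_closedBall_self dist_nonneg)
  rw [hn.sub_eq_of_ball_subset hpos hball, inner_neg_left, inner_smul_left] at h1
  have h3 : fderiv ℝ (fun y => Metric.infDist y Oᶜ) x (F x) = -⟪n, F x - F q⟫_ℝ := by
    rw [inner_sub_right, real_inner_comm (F q) n, hFq, sub_zero]
    refine mul_left_cancel₀ hpos.ne' ?_
    rw [h1]; simp
  rw [h3, abs_neg, hd, dist_eq_norm]
  refine (abs_real_inner_le_norm _ _).trans ?_
  rwa [hn.norm_eq_one, one_mul]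

/-- The divergence theorem for a tangential vector field. -/
theorem setIntegral_divWithin_eq_zero (hO : IsOpen O) (hOb : Bornology.IsBounded O)
    (hne : (Oᶜ).Nonempty) (hF : ContDiffOn ℝ 1 F (closure O))
    (hFn : ∀ q ∈ frontier O, ∃ n, IsConeNormal O q n ∧ ⟪F q, n⟫_ℝ = 0) :
    ∫ x in O, divWithin F (closure O) x = 0 := by
  have hu : UniqueDiffOn ℝ (closure O) := hO.uniqueDiffOn_closure_of_isConeNormal
    fun q hq => (hFn q hq).imp fun n h => h.1
  have hcomp : IsCompact (closure O) := hOb.isCompact_closure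
  have hcont : ContinuousOn (fun x => fderivWithin ℝ F (closure O) x) (closure O) :=
    hF.continuousOn_fderivWithin hu le_rfl
  obtain ⟨C, hC⟩ := hcomp.exists_bound_of_continuousOn hcont
  obtain ⟨L, hL⟩ := exists_deriv_smoothTransition_bound
  have hmem : ∀ x ∈ O, closure O ∈ 𝓝 x := fun x hx =>
    mem_of_superset (hO.mem_nhds hx) subset_closure
  have hdiv : ContinuousOn (divWithin F (closure O)) (closure O) := by
    unfold divWithin
    refine continuousOn_finsetSum _ fun k _ => ?_
    exact (EuclideanSpace.proj (𝕜 := ℝ) k).continuous.comp_continuousOn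
      (hcont.clm_apply continuousOn_const)
  obtain ⟨M, hM⟩ := hcomp.exists_bound_of_continuousOn hdiv
  have hfin : volume O < ⊤ := hOb.measure_lt_top
  have : IsFiniteMeasure (volume.restrict O) := ⟨by simpa using hfin⟩
  set δ : EuclideanSpace ℝ (Fin d) → ℝ := fun y => Metric.infDist y Oᶜ with hδ
  have hδL : LipschitzWith 1 δ := Metric.lipschitz_infDist_pt _
  have hδpos : ∀ x ∈ O, 0 < δ x := fun x hx =>
    (hO.isClosed_compl.notMem_iff_infDist_pos hne).1 (fun h => h hx)
  have hσd : Differentiable ℝ Real.smoothTransition :=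
    (Real.smoothTransition.contDiff (n := 1)).differentiable one_ne_zero
  have hσL : LipschitzWith L Real.smoothTransition := lipschitzWith_of_nnnorm_deriv_le hσd hL
  -- The cutoff is `0` where `k δ ≤ 1` and `1` where `k δ ≥ 2`; the shift by `1` keeps its closed
  -- support inside `O`.
  let χ : ℕ → EuclideanSpace ℝ (Fin d) → ℝ := fun k x => Real.smoothTransition (k * δ x - 1)
  have hχL : ∀ k, ∃ D, LipschitzWith D (χ k) := by
    intro k
    refine ⟨_, hσL.comp ((LipschitzWith.of_dist_le_mul (K := (k : NNReal)) fun x y => ?_) :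
      LipschitzWith (k : NNReal) fun x => (k : ℝ) * δ x - 1)⟩
    have := hδL.dist_le_mul x y
    rw [Real.dist_eq] at this ⊢
    rw [show (k : ℝ) * δ x - 1 - (k * δ y - 1) = k * (δ x - δ y) by ring, abs_mul, Nat.abs_cast]
    simp only [NNReal.coe_one, one_mul] at this
    simpa using mul_le_mul_of_nonneg_left this (Nat.cast_nonneg k)
  have hχs : ∀ k, tsupport (χ k) ⊆ O := by
    intro k
    have h1 : tsupport (χ k) ⊆ {x | 1 ≤ k * δ x} := by
      refine closure_minimal (fun x hx => ?_)
        (isClosed_le continuous_const (continuous_const.mul hδL.continuous))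
      by_contra h
      exact hx (Real.smoothTransition.zero_of_nonpos (by
        have : (k : ℝ) * δ x < 1 := not_le.1 h
        linarith))
    intro x hx
    by_contra hxO
    have h2 : (1 : ℝ) ≤ k * δ x := h1 hx
    have h3 : δ x = 0 := Metric.infDist_zero_of_mem hxO
    rw [h3] at h2; norm_num at h2
  have hχc : ∀ k, HasCompactSupport (χ k) := fun k =>
    HasCompactSupport.of_support_subset_isCompact hcomp
      ((subset_tsupport _).trans ((hχs k).trans subset_closure))
  have hχ1 : ∀ x ∈ O, ∀ᶠ k : ℕ in atTop, 1 < k * δ x - 1 := by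
    intro x hx
    have : Tendsto (fun k : ℕ => (k : ℝ) * δ x - 1) atTop atTop :=
      tendsto_atTop_add_const_right _ _
        (tendsto_natCast_atTop_atTop.atTop_mul_const (hδpos x hx))
    exact this.eventually_gt_atTop 1
  have hσ1 : ∀ y : ℝ, 1 < y → deriv Real.smoothTransition y = 0 := by
    intro y hy
    have : Real.smoothTransition =ᶠ[𝓝 y] fun _ => 1 := by
      filter_upwards [Ioi_mem_nhds hy] with z hz
        using Real.smoothTransition.one_of_one_le (le_of_lt hz)
    rw [this.deriv_eq, deriv_const]
  have hχd : ∀ k x, DifferentiableAt ℝ δ x → fderiv ℝ (χ k) x (F x)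
      = deriv Real.smoothTransition (k * δ x - 1) * (k * fderiv ℝ δ x (F x)) := by
    intro k x hx
    have h1 : HasFDerivAt (fun y => (k : ℝ) * δ y - 1) ((k : ℝ) • fderiv ℝ δ x) x :=
      (hx.hasFDerivAt.const_mul (k : ℝ)).sub_const 1
    have h2 := (hσd (k * δ x - 1)).hasDerivAt.comp_hasFDerivAt x h1
    have h3 : fderiv ℝ (χ k) x = _ := h2.fderiv
    rw [h3]
    simp
  have hparts : ∀ k, ∫ x in O, χ k x * divWithin F (closure O) x
      = -∫ x in O, fderiv ℝ (χ k) x (F x) := by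
    intro k
    obtain ⟨D, hD⟩ := hχL k
    have := integral_mul_divWithin_univ hO (hF.mono subset_closure) hD (hχc k) (hχs k)
    have h1 : ∫ x in O, χ k x * divWithin F univ x = ∫ x, χ k x * divWithin F univ x :=
      setIntegral_eq_integral_of_forall_compl_eq_zero fun x hx => by
        rw [image_eq_zero_of_notMem_tsupport fun h => hx (hχs k h), zero_mul]
    have h2 : ∫ x in O, fderiv ℝ (χ k) x (F x) = ∫ x, fderiv ℝ (χ k) x (F x) :=
      setIntegral_eq_integral_of_forall_compl_eq_zero fun x hx => by
        rw [(notMem_tsupport_iff_eventuallyEq.1 fun h => hx (hχs k h)).fderiv_eq]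
        simp
    rw [h2, ← this, ← h1]
    refine setIntegral_congr_fun hO.measurableSet fun x hx => ?_
    simp only [divWithin, fderivWithin_univ, fderivWithin_of_mem_nhds (hmem x hx)]
  have hlim1 : Tendsto (fun k => ∫ x in O, χ k x * divWithin F (closure O) x) atTop
      (𝓝 (∫ x in O, divWithin F (closure O) x)) := by
    refine tendsto_integral_of_dominated_convergence (fun _ => M) (fun k => ?_)
      (integrable_const M) (fun k => ?_) ?_
    · obtain ⟨D, hD⟩ := hχL k
      exact (hD.continuous.continuousOn.mul (hdiv.mono subset_closure)).aestronglyMeasurable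
        hO.measurableSet
    · filter_upwards [ae_restrict_mem hO.measurableSet] with x hx
      rw [norm_mul, Real.norm_of_nonneg (Real.smoothTransition.nonneg _)]
      exact (mul_le_of_le_one_left (norm_nonneg _) (Real.smoothTransition.le_one _)).trans
        (hM x (subset_closure hx))
    · filter_upwards [ae_restrict_mem hO.measurableSet] with x hx
      refine tendsto_const_nhds.congr' ?_
      filter_upwards [hχ1 x hx] with k hk
      simp only [χ]
      rw [Real.smoothTransition.one_of_one_le hk.le, one_mul]
  have hlim2 : Tendsto (fun k => ∫ x in O, fderiv ℝ (χ k) x (F x)) atTop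
      (𝓝 (∫ x in O, (0 : ℝ))) := by
    -- The derivative of the cutoff along `F` vanishes where `k δ > 2`. Elsewhere it is at most `L k
    -- |∂_F δ| ≤ L k C δ ≤ 2 L C`, so tangency absorbs the factor `k`.
    refine tendsto_integral_of_dominated_convergence (fun _ => L * (2 * C)) (fun k => ?_)
      (integrable_const _) (fun k => ?_) ?_
    · have h1 : AEStronglyMeasurable (fun x => fderiv ℝ (χ k) x) (volume.restrict O) :=
        (measurable_fderiv ℝ (χ k)).aestronglyMeasurable
      have h2 : AEStronglyMeasurable F (volume.restrict O) :=
        (hF.continuousOn.mono subset_closure).aestronglyMeasurable hO.measurableSet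
      exact (ContinuousLinearMap.apply ℝ ℝ).flip.aestronglyMeasurable_comp₂ h1 h2
    · filter_upwards [ae_restrict_mem hO.measurableSet,
        ae_restrict_of_ae (hδL.ae_differentiableAt (μ := volume))] with x hx hdx
      rw [hχd k x hdx]
      have hb := abs_fderiv_infDist_compl_le hO hne (hF.differentiableOn one_ne_zero) hC hFn hx hdx
      have hC0 : 0 ≤ C := (norm_nonneg _).trans (hC x (subset_closure hx))
      by_cases h1 : 1 < k * δ x - 1
      · rw [hσ1 _ h1, zero_mul, norm_zero]
        positivity
      · rw [norm_mul]
        have hL' : ‖deriv Real.smoothTransition (k * δ x - 1)‖ ≤ L := hL _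
        refine mul_le_mul hL' ?_ (norm_nonneg _) L.2
        rw [Real.norm_eq_abs, abs_mul, Nat.abs_cast]
        calc (k : ℝ) * |fderiv ℝ δ x (F x)| ≤ k * (C * δ x) :=
              mul_le_mul_of_nonneg_left hb (Nat.cast_nonneg k)
          _ = (k * δ x) * C := by ring
          _ ≤ 2 * C := mul_le_mul_of_nonneg_right (by linarith [not_lt.1 h1]) hC0
    · filter_upwards [ae_restrict_mem hO.measurableSet,
        ae_restrict_of_ae (hδL.ae_differentiableAt (μ := volume))] with x hx hdx
      refine tendsto_const_nhds.congr' ?_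
      filter_upwards [hχ1 x hx] with k hk
      rw [hχd k x hdx, hσ1 _ hk, zero_mul]
  simp_rw [hparts] at hlim1
  have := tendsto_nhds_unique hlim1 hlim2.neg
  simpa using this

end Divergence

/-! ### The Killing property of the coefficient fields -/

section Killing

open MeasureTheory

variable {d : ℕ}

theorem EuclideanSpace.sum_smul_single (v : EuclideanSpace ℝ (Fin d)) :
    ∑ k, v k • EuclideanSpace.single k (1 : ℝ) = v := by
  simpa using (EuclideanSpace.basisFun (Fin d) ℝ).sum_repr v

/-- The field `(Db + (Db)ᵀ) b` built from the symmetrized derivative of `b`. -/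
noncomputable def symmGradField (b : EuclideanSpace ℝ (Fin d) → EuclideanSpace ℝ (Fin d))
    (K : Set (EuclideanSpace ℝ (Fin d))) (x : EuclideanSpace ℝ (Fin d)) :
    EuclideanSpace ℝ (Fin d) :=
  WithLp.toLp 2 fun k => fderivWithin ℝ b K x (b x) k
    + ⟪fderivWithin ℝ b K x (EuclideanSpace.single k 1), b x⟫_ℝ

variable {b : EuclideanSpace ℝ (Fin d) → EuclideanSpace ℝ (Fin d)}
  {K : Set (EuclideanSpace ℝ (Fin d))}

theorem inner_symmGradField (x n : EuclideanSpace ℝ (Fin d)) :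
    ⟪symmGradField b K x, n⟫_ℝ
      = ⟪fderivWithin ℝ b K x n, b x⟫_ℝ + ⟪fderivWithin ℝ b K x (b x), n⟫_ℝ := by
  conv_rhs => enter [1]; rw [← EuclideanSpace.sum_smul_single n, map_sum, sum_inner]
  rw [PiLp.inner_apply, PiLp.inner_apply, ← Finset.sum_add_distrib]
  refine Finset.sum_congr rfl fun k _ => ?_
  simp only [symmGradField, map_smul, inner_smul_left, conj_trivial, RCLike.inner_apply]
  ring

theorem ContDiffOn.symmGradField (hb : ContDiffOn ℝ 2 b K) (hK : UniqueDiffOn ℝ K) :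
    ContDiffOn ℝ 1 (symmGradField b K) K := by
  have hD : ContDiffOn ℝ 1 (fderivWithin ℝ b K) K := hb.fderivWithin hK (by norm_num)
  have hb1 : ContDiffOn ℝ 1 b K := hb.of_le (by norm_num)
  rw [contDiffOn_euclidean]
  intro k
  exact ((contDiffOn_euclidean.1 (hD.clm_apply hb1)) k).add
    ((hD.clm_apply contDiffOn_const).inner ℝ hb1)

/-- The divergence of `(Db + (Db)ᵀ) b` is half of the squared norm of the symmetrized derivative,
when `b` is divergence free and orthogonal to its Laplacian. -/
theorem divWithin_symmGradField (hb : ContDiffOn ℝ 2 b K) (hK : UniqueDiffOn ℝ K)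
    {x : EuclideanSpace ℝ (Fin d)} (hx : x ∈ K) (hxi : x ∈ closure (interior K))
    (hdiv : ∀ y ∈ K, divWithin b K y = 0)
    (hlap : ⟪InnerProductSpace.laplacianWithin b K x, b x⟫_ℝ = 0) :
    divWithin (symmGradField b K) K x
      = 2⁻¹ * ∑ k, ∑ j, (fderivWithin ℝ b K x (EuclideanSpace.single k 1) j
        + fderivWithin ℝ b K x (EuclideanSpace.single j 1) k) ^ 2 := by
  set D := fderivWithin ℝ b K with hDdef
  have hD : ContDiffOn ℝ 1 D K := hb.fderivWithin hK (by norm_num)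
  have hD' : HasFDerivWithinAt D (fderivWithin ℝ D K x) K x :=
    (hD.differentiableOn one_ne_zero x hx).hasFDerivWithinAt
  have hb' : HasFDerivWithinAt b (D x) K x :=
    (hb.differentiableOn two_ne_zero x hx).hasFDerivWithinAt
  set D2 := fderivWithin ℝ D K x with hD2
  let e : Fin d → EuclideanSpace ℝ (Fin d) := fun k => EuclideanSpace.single k 1
  have hsymm : ∀ v w, D2 v w = D2 w v :=
    (hb x hx).isSymmSndFDerivWithinAt (by simp) hK hxi hx
  have hS : HasFDerivWithinAt (symmGradField b K) (fderivWithin ℝ (symmGradField b K) K x) K x :=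
    ((hb.symmGradField hK).differentiableOn one_ne_zero x hx).hasFDerivWithinAt
  have hcomp : ∀ k, fderivWithin ℝ (symmGradField b K) K x (e k) k
      = D2 (b x) (e k) k + D x (D x (e k)) k
        + (⟪D2 (e k) (e k), b x⟫_ℝ + ⟪D x (e k), D x (e k)⟫_ℝ) := by
    intro k
    have h1 := (EuclideanSpace.proj (𝕜 := ℝ) k).hasFDerivAt.comp_hasFDerivWithinAt x hS
    have h2 := ((EuclideanSpace.proj (𝕜 := ℝ) k).hasFDerivAt.comp_hasFDerivWithinAt x
      (hD'.clm_apply hb')).add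
      ((hD'.clm_apply (hasFDerivWithinAt_const (e k) x K)).inner ℝ hb')
    have h3 := congrArg (fun l => l (e k)) ((hK x hx).eq h1 h2)
    simp at h3
    rw [h3, hsymm (e k) (b x), real_inner_self_eq_norm_sq]
    ring
  -- This sum is the derivative along `b x` of the function `div b`, which is zero on `K`.
  have hdiv2 : ∑ k, D2 (b x) (e k) k = 0 := by
    have h1 : HasFDerivWithinAt (divWithin b K) (∑ k, (EuclideanSpace.proj (𝕜 := ℝ) k).comp
        (D2.flip (e k))) K x := by
      refine HasFDerivWithinAt.fun_sum fun k _ => ?_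
      exact (EuclideanSpace.proj (𝕜 := ℝ) k).hasFDerivAt.comp_hasFDerivWithinAt x
        (by simpa using hD'.clm_apply (hasFDerivWithinAt_const (e k) x K))
    have h2 : HasFDerivWithinAt (divWithin b K)
        (0 : EuclideanSpace ℝ (Fin d) →L[ℝ] ℝ) K x :=
      (hasFDerivWithinAt_const (0 : ℝ) x K).congr hdiv (hdiv x hx)
    have h3 := congrArg (fun l => l (b x)) ((hK x hx).eq h1 h2)
    simpa using h3
  have hlap2 : ∑ k, ⟪D2 (e k) (e k), b x⟫_ℝ = 0 := by
    rw [InnerProductSpace.laplacianWithin_eq_iteratedFDerivWithin_orthonormalBasis b hK hx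
      (EuclideanSpace.basisFun (Fin d) ℝ), sum_inner] at hlap
    rw [← hlap]
    refine Finset.sum_congr rfl fun k _ => ?_
    rw [iteratedFDerivWithin_two_apply b hK hx]
    simp [e, hD2, hDdef]
  have hDD : ∀ k, D x (D x (e k)) k = ∑ j, D x (e k) j * D x (e j) k := by
    intro k
    conv_lhs => rw [← EuclideanSpace.sum_smul_single (D x (e k)), map_sum]
    simp [e]
  have hnorm : ∀ k, ⟪D x (e k), D x (e k)⟫_ℝ = ∑ j, D x (e k) j ^ 2 := by
    intro k
    rw [PiLp.inner_apply]
    exact Finset.sum_congr rfl fun j _ => by simp [pow_two]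
  have hswap : ∑ k, ∑ j, D x (e j) k ^ 2 = ∑ k, ∑ j, D x (e k) j ^ 2 := Finset.sum_comm
  calc divWithin (symmGradField b K) K x
      = ∑ k, (D2 (b x) (e k) k + D x (D x (e k)) k
        + (⟪D2 (e k) (e k), b x⟫_ℝ + ⟪D x (e k), D x (e k)⟫_ℝ)) :=
        Finset.sum_congr rfl fun k _ => hcomp k
    _ = ∑ k, ∑ j, D x (e k) j * D x (e j) k + ∑ k, ∑ j, D x (e k) j ^ 2 := by
        rw [Finset.sum_add_distrib, Finset.sum_add_distrib, Finset.sum_add_distrib, hdiv2, hlap2]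
        simp only [hDD, hnorm]
        ring
    _ = 2⁻¹ * ∑ k, ∑ j, (D x (e k) j + D x (e j) k) ^ 2 := by
        simp only [add_sq, Finset.sum_add_distrib, hswap, mul_assoc, ← Finset.mul_sum]
        ring

/-- A divergence free field tangent to the boundary with `⟨Δb, b⟩ = 0` and vanishing tangential
boundary stress is a Killing field. -/
theorem inner_fderivWithin_add_inner_eq_zero {O : Set (EuclideanSpace ℝ (Fin d))} (hO : IsOpen O)
    (hOb : Bornology.IsBounded O) (hne : (Oᶜ).Nonempty) (hb : ContDiffOn ℝ 2 b (closure O))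
    (hdiv : ∀ y ∈ closure O, divWithin b (closure O) y = 0)
    (hlap : ∀ x ∈ closure O, ⟪InnerProductSpace.laplacianWithin b (closure O) x, b x⟫_ℝ = 0)
    (hbd : ∀ q ∈ frontier O, ∃ n, IsConeNormal O q n ∧
      ⟪fderivWithin ℝ b (closure O) q n, b q⟫_ℝ
        + ⟪fderivWithin ℝ b (closure O) q (b q), n⟫_ℝ = 0)
    {x : EuclideanSpace ℝ (Fin d)} (hx : x ∈ closure O) (v w : EuclideanSpace ℝ (Fin d)) :
    ⟪fderivWithin ℝ b (closure O) x v, w⟫_ℝ + ⟪fderivWithin ℝ b (closure O) x w, v⟫_ℝ = 0 := by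
  have hK : UniqueDiffOn ℝ (closure O) := hO.uniqueDiffOn_closure_of_isConeNormal
    fun q hq => (hbd q hq).imp fun n h => h.1
  have hF := hb.symmGradField hK
  have hint : closure O ⊆ closure (interior (closure O)) :=
    closure_mono hO.subset_interior_closure
  have hzero := setIntegral_divWithin_eq_zero hO hOb hne hF fun q hq => by
    obtain ⟨n, hn, h⟩ := hbd q hq
    exact ⟨n, hn, by rw [inner_symmGradField, h]⟩
  have heq := fun y (hy : y ∈ closure O) =>
    divWithin_symmGradField hb hK hy (hint hy) hdiv (hlap y hy)
  have hnonneg : ∀ y ∈ closure O, 0 ≤ divWithin (symmGradField b (closure O)) (closure O) y :=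
    fun y hy => by rw [heq y hy]; positivity
  have hcont : ContinuousOn (divWithin (symmGradField b (closure O)) (closure O)) (closure O) := by
    unfold divWithin
    refine continuousOn_finsetSum _ fun k _ => ?_
    exact (EuclideanSpace.proj (𝕜 := ℝ) k).continuous.comp_continuousOn
      ((hF.continuousOn_fderivWithin hK le_rfl).clm_apply continuousOn_const)
  have hintb : IntegrableOn (divWithin (symmGradField b (closure O)) (closure O)) O :=
    (hcont.integrableOn_compact hOb.isCompact_closure).mono_set subset_closure
  have hae := (setIntegral_eq_zero_iff_of_nonneg_ae
    ((ae_restrict_mem hO.measurableSet).mono fun y hy => hnonneg y (subset_closure hy)) hintb).1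
    hzero
  -- Continuity upgrades vanishing almost everywhere to vanishing on `O`, then on its closure; a
  -- vanishing sum of squares then kills each entry.
  have hEqO : EqOn (divWithin (symmGradField b (closure O)) (closure O)) 0 O :=
    Measure.eqOn_open_of_ae_eq hae hO (hcont.mono subset_closure) continuousOn_const
  have hEq : EqOn (divWithin (symmGradField b (closure O)) (closure O)) 0 (closure O) :=
    hEqO.of_subset_closure hcont continuousOn_const subset_closure subset_rfl
  have h0 := hEq hx
  rw [heq x hx] at h0
  have hent : ∀ k j, fderivWithin ℝ b (closure O) x (EuclideanSpace.single k 1) j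
      + fderivWithin ℝ b (closure O) x (EuclideanSpace.single j 1) k = 0 := by
    intro k j
    have h1 := (mul_eq_zero.1 h0).resolve_left (by norm_num)
    have h2 := (Finset.sum_eq_zero_iff_of_nonneg
      (fun k _ => Finset.sum_nonneg fun j _ => sq_nonneg _)).1 h1 k (Finset.mem_univ k)
    exact pow_eq_zero_iff two_ne_zero |>.1 ((Finset.sum_eq_zero_iff_of_nonneg
      (fun j _ => sq_nonneg _)).1 h2 j (Finset.mem_univ j))
  have hexp : ∀ v w : EuclideanSpace ℝ (Fin d), ⟪fderivWithin ℝ b (closure O) x v, w⟫_ℝ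
      = ∑ k, ∑ j, v k * w j * fderivWithin ℝ b (closure O) x (EuclideanSpace.single k 1) j := by
    intro v w
    conv_lhs => rw [← EuclideanSpace.sum_smul_single v, map_sum, sum_inner]
    refine Finset.sum_congr rfl fun k _ => ?_
    rw [map_smul, PiLp.inner_apply]
    refine Finset.sum_congr rfl fun j _ => ?_
    simp
    ring
  rw [hexp v w, hexp w v, Finset.sum_comm (f := fun k j => w k * v j * _),
    ← Finset.sum_add_distrib]
  refine Finset.sum_eq_zero fun k _ => ?_
  rw [← Finset.sum_add_distrib]
  refine Finset.sum_eq_zero fun j _ => ?_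
  linear_combination v k * w j * hent k j

end Killing

/-! ### The Neumann condition for `⟨b, ∇u⟩` -/

/-- Lets `⟨∇u, ∇ρ⟩` be written in coordinates through the two differentials, ready for the product
rule. -/
theorem sum_apply_single_mul_apply_single {d : ℕ} (l m : EuclideanSpace ℝ (Fin d) →L[ℝ] ℝ)
    {g : EuclideanSpace ℝ (Fin d)} (hg : ∀ v, m v = ⟪g, v⟫_ℝ) :
    ∑ k, l (EuclideanSpace.single k 1) * m (EuclideanSpace.single k 1) = l g := by
  conv_rhs => rw [← EuclideanSpace.sum_smul_single g, map_sum]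
  refine Finset.sum_congr rfl fun k _ => ?_
  rw [hg, map_smul, smul_eq_mul, mul_comm, EuclideanSpace.inner_single_right]
  simp

theorem lemma2p6 {d N : ℕ} (O : Set (EuclideanSpace ℝ (Fin d)))
    (hO : IsOpen O) (hOb : Bornology.IsBounded O) (hO2 : HasC2Boundary O)
    (ν : EuclideanSpace ℝ (Fin d) → EuclideanSpace ℝ (Fin d))
    (hν : ∀ x ∈ frontier O, IsOuterUnitNormal O x (ν x))
    (b : Fin N → EuclideanSpace ℝ (Fin d) → EuclideanSpace ℝ (Fin d))
    (hb : NoiseAssumption O ν b)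
    (u : EuclideanSpace ℝ (Fin d) → ℝ) (hu : ContDiffOn ℝ 3 u (closure O))
    (huν : ZeroNormalDerivative O ν u) (i : Fin N) :
    ContDiffOn ℝ 2 (noiseOp (closure O) (b i) u) (closure O) ∧
      ZeroNormalDerivative O ν (noiseOp (closure O) (b i) u) := by
  have hK : UniqueDiffOn ℝ (closure O) := hO.uniqueDiffOn_closure_of_isConeNormal
    fun q hq => ⟨ν q, (hν q hq).isConeNormal⟩
  have hop : noiseOp (closure O) (b i) u = fun x => fderivWithin ℝ u (closure O) x (b i x) := by
    funext x
    rw [noiseOp, real_inner_comm, inner_gradientWithin_left]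
  have hDu : ContDiffOn ℝ 2 (fderivWithin ℝ u (closure O)) (closure O) :=
    hu.fderivWithin hK (by norm_num)
  have hbi := hb.contDiffOn i
  rw [hop]
  refine ⟨hDu.clm_apply hbi, fun p hp => ?_⟩
  have hpK : p ∈ closure O := frontier_subset_closure hp
  have hne : (Oᶜ).Nonempty := ⟨p, by rw [hO.frontier_eq] at hp; exact hp.2⟩
  have hcone := (hν p hp).isConeNormal
  obtain ⟨ρ, hρ, hνρ⟩ := hν p hp
  set a := gradient ρ p with ha
  set g := gradientWithin u (closure O) p with hg
  set D := fderivWithin ℝ (b i) (closure O) p with hD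
  have hkill : ⟪D a, g⟫_ℝ + ⟪D g, a⟫_ℝ = 0 :=
    inner_fderivWithin_add_inner_eq_zero hO hOb hne hbi (hb.div_eq_zero i) (hb.laplacian i)
      (fun q hq => ⟨ν q, (hν q hq).isConeNormal, hb.boundary i q hq⟩) hpK a g
  have hbD : HasFDerivWithinAt (b i) D (closure O) p :=
    (hbi.differentiableOn two_ne_zero p hpK).hasFDerivWithinAt
  have hDu' : HasFDerivWithinAt (fderivWithin ℝ u (closure O))
      (fderivWithin ℝ (fderivWithin ℝ u (closure O)) (closure O) p) (closure O) p :=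
    (hDu.differentiableOn two_ne_zero p hpK).hasFDerivWithinAt
  set U2 := fderivWithin ℝ (fderivWithin ℝ u (closure O)) (closure O) p with hU2
  have hU2symm : ∀ v w, U2 v w = U2 w v :=
    (hu p hpK).isSymmSndFDerivWithinAt (by simp; norm_num) hK
      (closure_mono hO.subset_interior_closure hpK) hpK
  have hRd : HasFDerivAt (fderiv ℝ ρ) (fderiv ℝ (fderiv ℝ ρ) p) p :=
    ((hρ.contDiffAt.fderiv_right (m := 1) (by norm_num)).differentiableAt one_ne_zero).hasFDerivAt
  set R2 := fderiv ℝ (fderiv ℝ ρ) p with hR2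
  have hR2symm : ∀ v w, R2 v w = R2 w v := hρ.contDiffAt.isSymmSndFDerivAt (by simp)
  have hRdw := hRd.hasFDerivWithinAt (s := closure O)
  have hnormal : ∀ᶠ q in 𝓝[frontier O] p, ∃ c : ℝ, fderiv ℝ ρ q = c • innerSL ℝ (ν q) := by
    filter_upwards [hρ.eventually_frontier hO, self_mem_nhdsWithin] with q hq hqf
    have h1 := hq.isConeNormal.unique (hν q hqf).isConeNormal
    refine ⟨‖gradient ρ q‖, ContinuousLinearMap.ext fun v => ?_⟩
    rw [← h1, ← inner_gradient_left]
    simp [norm_ne_zero_iff.2 hq.gradient_ne_zero]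
  have hRa : ∀ v, fderiv ℝ ρ p v = ⟪a, v⟫_ℝ := fun v => by rw [ha, inner_gradient_left]
  have hUg : ∀ v, fderivWithin ℝ u (closure O) p v = ⟪g, v⟫_ℝ := fun v => by
    rw [hg, inner_gradientWithin_left]
  -- differentiate `⟨b, ∇ρ⟩ = 0` along `∇u`
  have hbρ : R2 g (b i p) + ⟪a, D g⟫_ℝ = 0 := by
    have h1 := (hRdw.clm_apply hbD).eq_zero_of_tangent hcone (w := g)
      (by rw [real_inner_comm]; exact huν p hp) frontier_subset_closure hp (by
        filter_upwards [hnormal, self_mem_nhdsWithin] with q ⟨c, hc⟩ hqf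
        have := hb.tangent i q hqf
        rw [real_inner_comm] at this
        simp [hc, this])
    simp [hRa] at h1
    linarith
  -- differentiate `⟨∇u, ∇ρ⟩ = 0` along `b`
  have huρ : U2 (b i p) a + R2 (b i p) g = 0 := by
    have h1 : HasFDerivWithinAt (fun x => ∑ k, fderivWithin ℝ u (closure O) x
        (EuclideanSpace.single k 1) * fderiv ℝ ρ x (EuclideanSpace.single k 1)) _ (closure O) p :=
      HasFDerivWithinAt.fun_sum fun k (_ : k ∈ Finset.univ) =>
        (hDu'.clm_apply (hasFDerivWithinAt_const (EuclideanSpace.single k (1 : ℝ)) p _)).mul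
          (hRdw.clm_apply (hasFDerivWithinAt_const (EuclideanSpace.single k (1 : ℝ)) p _))
    have h2 := h1.eq_zero_of_tangent hcone (w := b i p)
      (by rw [real_inner_comm]; exact hb.tangent i p hp) frontier_subset_closure hp (by
        filter_upwards [hnormal, self_mem_nhdsWithin] with q ⟨c, hc⟩ hqf
        rw [sum_apply_single_mul_apply_single _ _ (g := c • ν q) (by
          intro v; simp [hc, inner_smul_left])]
        rw [map_smul, ← inner_gradientWithin_left, huν q hqf, smul_zero])
    rw [← sum_apply_single_mul_apply_single (U2 (b i p)) _ hRa,
      ← sum_apply_single_mul_apply_single (R2 (b i p)) _ hUg, ← Finset.sum_add_distrib, ← h2]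
    simp only [sum_apply]
    refine Finset.sum_congr rfl fun k _ => ?_
    simp
    ring
  have hfinal : fderivWithin ℝ (fun x => fderivWithin ℝ u (closure O) x (b i x)) (closure O) p
      = _ := (hDu'.clm_apply hbD).fderivWithin (hK p hpK)
  rw [inner_gradientWithin_left, hfinal, hνρ, map_smul]
  -- Combines `hbρ`, `huρ` and `hkill`; the two terms in `R2` cancel by symmetry.
  have : U2 a (b i p) + ⟪g, D a⟫_ℝ = 0 := by
    rw [hU2symm, real_inner_comm (D a) g]
    rw [real_inner_comm] at hbρ
    linarith [hR2symm g (b i p)]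
  simp [hUg]
  right
  linarith
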